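/- Throughout, rings are commutative with identity. A Noetherian ring $R$ is Gorenstein if $R_{\mathfrak p}$ has finite injective dimension over itself for every prime $\mathfrak p$. **Definitions.** Let $R$ be a Noetherian ring. A finitely generated $R$-module $G$ belongs to the class $G(R)$ if $\operatorname{Ext}^i_R(G,R)=0=\operatorname{Ext}^i_R(\operatorname{Hom}_R(G,R),R)$ for all $i>0$ and the biduality map $G\to\operatorname{Hom}_R(\operatorname{Hom}_R(G,R),R)$ is an isomorphism. For a finitely generated module $M\neq 0$, $\operatorname{Gdim}_R M$ is the least integer $m\ge 0$ for which there is an exact sequence $0\to G_m\to\cdots\to G_0\to M\to 0$ with all $G_i\in G(R)$, and $\operatorname{Gdim}_R M=\infty$ if there is no such $m$; moreover $\operatorname{Gdim}_R 0=-\infty$. For $t\in\mathbb Z\cup\{-\infty\}$ put $$C_t(M)=\{\mathfrak p\in\operatorname{Spec}R \mid \operatorname{Gdim}_{R_{\mathfrak p}}M_{\mathfrak p}>t\},\qquad c_t(M)=\bigcap_{\mathfrak p\in C_t(M)}\mathfrak p,$$ where the empty intersection is $R$. For ideals $\mathfrak b\subseteq\mathfrak a$ of $R$ and an integer $n\ge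 0$ put $$\lambda_{\mathfrak a}^{\mathfrak b}(M)=\inf\{\operatorname{depth}M_{\mathfrak p}+\operatorname{ht}((\mathfrak a+\mathfrak p)/\mathfrak p)\mid \mathfrak p\in\operatorname{Spec}R,\ \mathfrak b\not\subseteq\mathfrak p\},$$ $$\lambda_{\mathfrak a}^{\mathfrak b}(M)_n=\inf\{\lambda_{\mathfrak aR_{\mathfrak p}}^{\mathfrak bR_{\mathfrak p}}(M_{\mathfrak p})\mid \mathfrak p\in\operatorname{Spec}R,\ \dim R/\mathfrak p\ge n\},$$ where the depth of the zero module, the height of the unit ideal and the infimum of the empty set are $\infty$. **Proposition 2.8.** Let $R$ be a Gorenstein ring, let $M$ be a finitely generated $R$-module, let $\mathfrak b\subseteq\mathfrak a$ be ideals of $R$, and let $n\ge 0$ be an integer. Then for every prime ideal $\mathfrak q\supseteq\mathfrak a$ with $\dim R/\mathfrak q\ge n$, $$\mathfrak bR_{\mathfrak q}\subseteq c_t(M_{\mathfrak q}),\qquad t=\operatorname{ht}\mathfrak q-\lambda_{\mathfrak a}^{\mathfrak b}(M)_n,$$ where $c_t(M_{\mathfrak q})$ is formed over the ring $R_{\mathfrak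 q}$, and $t=-\infty$ if $\lambda_{\mathfrak a}^{\mathfrak b}(M)_n=\infty$. -/

import Mathlib

universe u v

open CategoryTheory

noncomputable section

namespace GDim

/-- A commutative Noetherian ring is Gorenstein if each of its localizations at a prime ideal has
finite injective dimension as a module over itself. -/
class IsGorensteinRing (R : Type u) [CommRing R] : Prop extends IsNoetherianRing R where
  finite_injectiveDimension : ∀ (p : Ideal R) [p.IsPrime], ∃ n : ℕ,
    HasInjectiveDimensionLE
      (ModuleCat.of (Localization.AtPrime p) (Localization.AtPrime p)) n

/-- The class `G(R)`: finitely generated modules `G` with `Ext^i(G, R) = 0` and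
`Ext^i(Hom(G, R), R) = 0` for all `i > 0`, for which the biduality map is an isomorphism. -/
structure IsGClass (R : Type u) [CommRing R] (G : Type u) [AddCommGroup G] [Module R G] :
    Prop where
  finite : Module.Finite R G
  ext_self : ∀ i : ℕ, 0 < i →
    Subsingleton (Abelian.Ext (ModuleCat.of R G) (ModuleCat.of R R) i)
  ext_dual : ∀ i : ℕ, 0 < i →
    Subsingleton (Abelian.Ext (ModuleCat.of R (Module.Dual R G)) (ModuleCat.of R R) i)
  bijective_biduality : Function.Bijective (Module.Dual.eval R G)

/-- `M` has a `G`-resolution concentrated in degrees `0, …, n`, that is, an exact sequence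
`0 → G_n → ⋯ → G_1 → G_0 → M → 0` with all `G_l` in `G(R)`. -/
def HasGResolutionLE (R : Type u) [CommRing R] (M : Type v) [AddCommGroup M] [Module R M]
    (n : ℕ) : Prop :=
  ∃ (G : ℕ → ModuleCat.{u} R) (d : ∀ l, G (l + 1) →ₗ[R] G l) (ε : G 0 →ₗ[R] M),
    (∀ l, IsGClass R (G l)) ∧
    Function.Surjective ε ∧
    Function.Exact (d 0) ε ∧
    (∀ l, Function.Exact (d (l + 1)) (d l)) ∧
    ∀ l, n < l → Subsingleton (G l)

open Classical in
/-- The `G`-dimension of a module, with values in `{-∞} ∪ ℕ ∪ {∞}`: it is `-∞` for the zero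
module, and otherwise the least length of a `G`-resolution (`∞` if there is no finite one). -/
def gdim (R : Type u) [CommRing R] (M : Type v) [AddCommGroup M] [Module R M] : EReal :=
  if Subsingleton M then ⊥ else ⨅ (n : ℕ) (_ : HasGResolutionLE R M n), (n : EReal)

/-- `C_t(M)`, the set of primes `p` with `Gdim M_p > t`. -/
def gdimLocus (R : Type u) [CommRing R] (M : Type v) [AddCommGroup M] [Module R M]
    (t : EReal) : Set (PrimeSpectrum R) :=
  {p | t < gdim (Localization.AtPrime p.asIdeal) (LocalizedModule p.asIdeal.primeCompl M)}

/-- `c_t(M)`, the intersection of the primes in `C_t(M)` (the unit ideal if there are none). -/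
def gdimIdeal (R : Type u) [CommRing R] (M : Type v) [AddCommGroup M] [Module R M]
    (t : EReal) : Ideal R :=
  ⨅ p ∈ gdimLocus R M t, p.asIdeal

open Classical in
/-- The depth of a module over a local ring: the supremum of the lengths of regular sequences
in the maximal ideal, and `∞` for the zero module. -/
def depth (R : Type u) [CommRing R] [IsLocalRing R] (M : Type v) [AddCommGroup M] [Module R M] :
    ℕ∞ :=
  if Subsingleton M then ⊤ else
    ⨆ (rs : List R) (_ : ∀ r ∈ rs, r ∈ IsLocalRing.maximalIdeal R)
      (_ : RingTheory.Sequence.IsRegular M rs), (rs.length : ℕ∞)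

/-- The `b`-minimum `a`-adjusted depth
`λ_a^b(M) = inf {depth M_p + ht (a + p)/p | p prime, b ⊄ p}` of `M`.
The unit ideal has height `∞`. -/
def adjustedDepth {R : Type u} [CommRing R] (a b : Ideal R) (M : Type v) [AddCommGroup M]
    [Module R M] : ℕ∞ :=
  ⨅ (p : PrimeSpectrum R) (_ : ¬ b ≤ p.asIdeal),
    depth (Localization.AtPrime p.asIdeal) (LocalizedModule p.asIdeal.primeCompl M) +
      ((a ⊔ p.asIdeal).map (Ideal.Quotient.mk p.asIdeal)).height

/-- The `n`-th `b`-minimum `a`-adjusted depth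
`λ_a^b(M)_n = inf {λ_{aR_p}^{bR_p}(M_p) | p prime, dim R/p ≥ n}` of `M`. -/
def adjustedDepthAt {R : Type u} [CommRing R] (a b : Ideal R) (M : Type v) [AddCommGroup M]
    [Module R M] (n : ℕ) : ℕ∞ :=
  ⨅ (p : PrimeSpectrum R) (_ : (n : WithBot ℕ∞) ≤ ringKrullDim (R ⧸ p.asIdeal)),
    adjustedDepth
      (a.map (algebraMap R (Localization.AtPrime p.asIdeal)))
      (b.map (algebraMap R (Localization.AtPrime p.asIdeal)))
      (LocalizedModule p.asIdeal.primeCompl M)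

/-- The inclusion of `ℕ ∪ {∞}` in the extended reals. -/
def toEReal (x : ℕ∞) : EReal := ((x : ENNReal) : EReal)

end GDim

end

/-! Let `P` be a prime of `R_q` with `bR_q ⊄ P` and `N = (M_q)_P ≠ 0`. A Gorenstein local ring
satisfies the Auslander–Bridger bound `Gdim N ≤ ht P - depth N`
(`exists_depth_eq_and_hasGResolutionLE`). Taking `q`, then `P`, in the two infima gives `λ ≤ depth N
+ ht((a + P)/P)`. Also `ht P + ht((a + P)/P) ≤ dim R_q = ht q`, since `a` stays proper in `R_q`
(`height_add_height_map_le`). Adding up, `Gdim N ≤ ht q - λ`. The bound rests on three facts about a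
local ring of dimension at most `d` with finite injective dimension: `Ext^j(-, R)` vanishes for `j >
d` on finite modules (Bass); a regular sequence of length `m` on `N` improves this to `j > d - m`
for `N`; and a finite module with no higher `Ext` into `R` lies in `G(R)`, so syzygies yield the
resolution. -/

namespace GDim

/-! ### Vanishing of `Ext` along short exact sequences. -/

section LongExactSequence

open Abelian

variable {R : Type u} [CommRing R] {N₁ N₂ N₃ : Type u} [AddCommGroup N₁] [Module R N₁]
  [AddCommGroup N₂] [Module R N₂] [AddCommGroup N₃] [Module R N₃]

/-- The short complex of modules attached to an exact pair of linear maps. -/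
abbrev shortComplexOfExact (f : N₁ →ₗ[R] N₂) (g : N₂ →ₗ[R] N₃) (hfg : Function.Exact f g) :
    ShortComplex (ModuleCat.{u} R) :=
  ModuleCat.shortComplexOfCompEqZero f g hfg.linearMap_comp_eq_zero

theorem shortExact_of_exact {f : N₁ →ₗ[R] N₂} {g : N₂ →ₗ[R] N₃} (hf : Function.Injective f)
    (hg : Function.Surjective g) (hfg : Function.Exact f g) :
    (shortComplexOfExact f g hfg).ShortExact :=
  ModuleCat.shortComplex_shortExact _ hfg hf hg

variable {f : N₁ →ₗ[R] N₂} {g : N₂ →ₗ[R] N₃} (hf : Function.Injective f)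
  (hg : Function.Surjective g) (hfg : Function.Exact f g) (Y : ModuleCat.{u} R)

include hf hg hfg

theorem subsingleton_ext_middle {j : ℕ} (h₁ : Subsingleton (Ext (ModuleCat.of R N₁) Y j))
    (h₃ : Subsingleton (Ext (ModuleCat.of R N₃) Y j)) :
    Subsingleton (Ext (ModuleCat.of R N₂) Y j) := by
  refine subsingleton_of_forall_eq 0 fun x => ?_
  obtain ⟨y, rfl⟩ := Ext.contravariant_sequence_exact₂ (shortExact_of_exact hf hg hfg) Y x
    (h₁.elim _ _)
  rw [h₃.elim y 0, Ext.comp_zero]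

theorem subsingleton_ext_right {j : ℕ} (h₁ : Subsingleton (Ext (ModuleCat.of R N₁) Y j))
    (h₂ : Subsingleton (Ext (ModuleCat.of R N₂) Y (j + 1))) :
    Subsingleton (Ext (ModuleCat.of R N₃) Y (j + 1)) := by
  refine subsingleton_of_forall_eq 0 fun x => ?_
  obtain ⟨y, rfl⟩ := Ext.contravariant_sequence_exact₃ (shortExact_of_exact hf hg hfg) Y x
    (h₂.elim _ _) (Nat.add_comm 1 j)
  rw [h₁.elim y 0, Ext.comp_zero]

theorem subsingleton_ext_left {j : ℕ} (h₂ : Subsingleton (Ext (ModuleCat.of R N₂) Y j))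
    (h₃ : Subsingleton (Ext (ModuleCat.of R N₃) Y (j + 1))) :
    Subsingleton (Ext (ModuleCat.of R N₁) Y j) := by
  refine subsingleton_of_forall_eq 0 fun x => ?_
  obtain ⟨y, rfl⟩ := Ext.contravariant_sequence_exact₁ (shortExact_of_exact hf hg hfg) Y x
    (Nat.add_comm 1 j) (h₃.elim _ _)
  rw [h₂.elim y 0, Ext.comp_zero]

end LongExactSequence

section

open Abelian

variable {R : Type u} [CommRing R] {N N' : Type u} [AddCommGroup N] [Module R N]
  [AddCommGroup N'] [Module R N'] (Y : ModuleCat.{u} R)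

theorem subsingleton_ext_of_subsingleton [Subsingleton N] (j : ℕ) :
    Subsingleton (Ext (ModuleCat.of R N) Y j) := by
  refine subsingleton_of_forall_eq 0 fun x => ?_
  have h : (𝟙 (ModuleCat.of R N)) = 0 := by
    ext n
    exact Subsingleton.elim (α := N) _ _
  rw [← Ext.mk₀_id_comp x, h, Ext.mk₀_zero, Ext.zero_comp]

theorem subsingleton_ext_of_equiv (e : N ≃ₗ[R] N') {j : ℕ}
    (h : Subsingleton (Ext (ModuleCat.of R N') Y j)) :
    Subsingleton (Ext (ModuleCat.of R N) Y j) := by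
  refine subsingleton_of_forall_eq 0 fun x => ?_
  rw [← Ext.mk₀_id_comp x, ← e.toModuleIso.hom_inv_id, ← Ext.mk₀_comp_mk₀_assoc,
    h.elim ((Ext.mk₀ e.toModuleIso.inv).comp x (zero_add j)) 0, Ext.comp_zero]

theorem subsingleton_ext_zero_iff :
    Subsingleton (Ext (ModuleCat.of R N) Y 0) ↔ Subsingleton (N →ₗ[R] Y) :=
  (Ext.addEquiv₀.trans ModuleCat.homAddEquiv).toEquiv.subsingleton_congr

theorem subsingleton_ext_of_projective [Module.Projective R N] (j : ℕ) :
    Subsingleton (Ext (ModuleCat.of R N) Y (j + 1)) := by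
  have : Projective (ModuleCat.of R N) := (IsProjective.iff_projective N).1 inferInstance
  exact Ext.subsingleton_of_projective _ _ _

end

/-! ### Regular elements and Nakayama for `Ext`. -/

section Regular

open Abelian Pointwise IsLocalRing

variable {R : Type u} [CommRing R] [IsNoetherianRing R] [IsLocalRing R]
  {N : Type u} [AddCommGroup N] [Module R N] (Y : ModuleCat.{u} R)

/-- If multiplication by a nonunit on `Ext^j(N, Y)` is surjective then `Ext^j(N, Y) = 0`. -/
theorem subsingleton_ext_of_forall_exists_smul [Module.Finite R N] [Module.Finite R Y] {x : R}
    (hx : x ∈ maximalIdeal R) {j : ℕ}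
    (h : ∀ z : Ext (ModuleCat.of R N) Y j, ∃ y, x • y = z) :
    Subsingleton (Ext (ModuleCat.of R N) Y j) := by
  by_contra! ntr
  have : x ∈ (Module.annihilator R (Ext (ModuleCat.of R N) Y j)).jacobson :=
    IsLocalRing.maximalIdeal_le_jacobson _ hx
  refine absurd ?_ (Submodule.top_ne_pointwise_smul_of_mem_jacobson_annihilator this)
  rw [eq_comm, eq_top_iff]
  intro y _
  obtain ⟨z, rfl⟩ := h y
  exact Submodule.smul_mem_pointwise_smul _ _ ⊤ trivial

/-- The long exact sequence of multiplication by `x` makes `x` surjective on `Ext^j(N, Y)`, and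
Nakayama finishes. -/
theorem subsingleton_ext_of_quotSMulTop [Module.Finite R N] [Module.Finite R Y] {x : R}
    (hx : x ∈ maximalIdeal R) (reg : IsSMulRegular N x) {j : ℕ}
    (h : Subsingleton (Ext (ModuleCat.of R (QuotSMulTop x N)) Y (j + 1))) :
    Subsingleton (Ext (ModuleCat.of R N) Y j) := by
  refine subsingleton_ext_of_forall_exists_smul Y hx fun z => ?_
  have reg' : IsSMulRegular (ModuleCat.of R N) x := reg
  obtain ⟨y, rfl⟩ := Ext.contravariant_sequence_exact₁ reg'.smulShortComplex_shortExact Y z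
    (Nat.add_comm 1 j) (h.elim _ _)
  refine ⟨y, ?_⟩
  change Ext (ModuleCat.of R N) Y j at y
  have : (Ext.mk₀ (x • 𝟙 (ModuleCat.of R N))).comp y (zero_add j) = x • y := by
    rw [Ext.mk₀_smul, Ext.smul_comp, Ext.mk₀_id_comp]
  exact this.symm

omit [IsNoetherianRing R] [IsLocalRing R] in
theorem subsingleton_ext_quotSMulTop {x : R} (reg : IsSMulRegular N x) {j : ℕ}
    (h : Subsingleton (Ext (ModuleCat.of R N) Y j))
    (h' : Subsingleton (Ext (ModuleCat.of R N) Y (j + 1))) :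
    Subsingleton (Ext (ModuleCat.of R (QuotSMulTop x N)) Y (j + 1)) :=
  subsingleton_ext_right (f := LinearMap.lsmul R N x) reg (Submodule.mkQ_surjective _)
    (LinearMap.exact_lsmul_mkQ_smul_top N x) Y h h'

end Regular

/-! ### Bass's bound: injective dimension is at most Krull dimension. -/

section Bass

open Abelian IsLocalRing

variable {R : Type u} [CommRing R] [IsNoetherianRing R] [IsLocalRing R]
  (Y : ModuleCat.{u} R) [Module.Finite R Y]

/-- Dévissage by a prime filtration: for `p` not maximal, an element of the maximal ideal outside
`p` is regular on `R/p`, so vanishing descends from degree `r + 1`. -/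
theorem subsingleton_ext_of_subsingleton_ext_residueField {r : ℕ}
    (h : ∀ (N : Type u) [AddCommGroup N] [Module R N] [Module.Finite R N],
      Subsingleton (Ext (ModuleCat.of R N) Y (r + 1)))
    (hk : Subsingleton (Ext (ModuleCat.of R (R ⧸ maximalIdeal R)) Y r))
    (N : Type u) [AddCommGroup N] [Module R N] [hN : Module.Finite R N] :
    Subsingleton (Ext (ModuleCat.of R N) Y r) := by
  induction hN using IsNoetherianRing.induction_on_isQuotientEquivQuotientPrime R with
  | subsingleton N => exact subsingleton_ext_of_subsingleton Y r
  | quotient N p e =>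
    refine subsingleton_ext_of_equiv Y e ?_
    by_cases hp : maximalIdeal R ≤ p.1
    · have := (maximalIdeal.isMaximal R).eq_of_le p.2.ne_top hp
      rwa [← this]
    · obtain ⟨x, hx, hxp⟩ := SetLike.not_le_iff_exists.1 hp
      refine subsingleton_ext_of_quotSMulTop Y hx ?_ (h _)
      rw [isSMulRegular_iff_right_eq_zero_of_smul]
      intro m hm
      obtain ⟨a, rfl⟩ := Ideal.Quotient.mk_surjective m
      rw [← Ideal.Quotient.mk_eq_mk, ← Submodule.Quotient.mk_smul, Ideal.Quotient.mk_eq_mk,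
        Ideal.Quotient.eq_zero_iff_mem, smul_eq_mul] at hm
      exact Ideal.Quotient.eq_zero_iff_mem.2 ((p.2.mem_or_mem hm).resolve_left hxp)
  | exact N₁ N₂ N₃ f g hf hg hfg h₁ h₃ => exact subsingleton_ext_middle hf hg hfg Y h₁ h₃

theorem exists_isSMulRegular_or_exists_injective (N : Type u) [AddCommGroup N] [Module R N]
    [Module.Finite R N] :
    (∃ x ∈ maximalIdeal R, IsSMulRegular N x) ∨
      ∃ f : (R ⧸ maximalIdeal R) →ₗ[R] N, Function.Injective f := by
  by_cases h : Subsingleton ((R ⧸ maximalIdeal R) →ₗ[R] N)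
  · obtain ⟨x, hx, hreg⟩ := IsSMulRegular.subsingleton_linearMap_iff.1 h
    rw [Ideal.annihilator_quotient] at hx
    exact Or.inl ⟨x, hx, hreg⟩
  · right
    obtain ⟨f, hf⟩ := (@exists_ne _ (not_subsingleton_iff_nontrivial.1 h) 0)
    have : IsSimpleModule R (R ⧸ maximalIdeal R) :=
      isSimpleModule_iff_isCoatom.2 (maximalIdeal.isMaximal R).out
    exact ⟨f, LinearMap.injective_of_ne_zero hf⟩

-- A regular element trades one unit of `dim N` for one of `s`. Once none exists, `k` embeds in `N`;
-- as `Ext^(r+1)` vanishes on the cokernel, `Ext^r(N, Y)` surjects onto `Ext^r(k, Y) ≠ 0`, forcing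
-- `r ≤ s`.
omit [Module.Finite R Y] in
theorem le_add_of_supportDim_le {r : ℕ}
    (h : ∀ (N : Type u) [AddCommGroup N] [Module R N] [Module.Finite R N],
      Subsingleton (Ext (ModuleCat.of R N) Y (r + 1)))
    (hk : ¬ Subsingleton (Ext (ModuleCat.of R (R ⧸ maximalIdeal R)) Y r)) (d : ℕ) :
    ∀ (s : ℕ) (N : Type u) [AddCommGroup N] [Module R N] [Module.Finite R N] [Nontrivial N],
      (∀ j, s < j → Subsingleton (Ext (ModuleCat.of R N) Y j)) →
      Module.supportDim R N ≤ d → r ≤ s + d := by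
  induction d with
  | zero =>
    intro s N _ _ _ _ hN hd
    obtain ⟨x, hx, hreg⟩ | ⟨f, hf⟩ := exists_isSMulRegular_or_exists_injective (R := R) N
    · have := nontrivial_quotSMulTop_of_mem_maximalIdeal N hx
      rw [← Module.supportDim_quotSMulTop_succ_eq_supportDim hreg hx] at hd
      rw [Nat.cast_zero, ENat.WithBot.add_one_le_zero_iff,
        Module.supportDim_eq_bot_iff_subsingleton] at hd
      exact absurd hd (not_subsingleton _)
    · by_contra! hlt
      exact hk (subsingleton_ext_left hf (Submodule.mkQ_surjective _) f.exact_map_mkQ_range Y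
        (hN r (by omega)) (h _))
  | succ d ih =>
    intro s N _ _ _ _ hN hd
    obtain ⟨x, hx, hreg⟩ | ⟨f, hf⟩ := exists_isSMulRegular_or_exists_injective (R := R) N
    · have := nontrivial_quotSMulTop_of_mem_maximalIdeal N hx
      rw [← Module.supportDim_quotSMulTop_succ_eq_supportDim hreg hx] at hd
      have hd' : Module.supportDim R (QuotSMulTop x N) ≤ d := by
        push_cast at hd
        exact (ENat.WithBot.add_le_add_one_right_iff).1 hd
      have := ih (s + 1) (QuotSMulTop x N) (fun j hj => by
        obtain ⟨j, rfl⟩ : ∃ i, j = i + 1 := ⟨j - 1, by omega⟩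
        exact subsingleton_ext_quotSMulTop Y hreg (hN _ (by omega)) (hN _ (by omega))) hd'
      omega
    · by_contra! hlt
      exact hk (subsingleton_ext_left hf (Submodule.mkQ_surjective _) f.exact_map_mkQ_range Y
        (hN r (by omega)) (h _))

/-- Over a Noetherian local ring of dimension `d`, if `Ext^j(-, Y)` vanishes on finite modules for
all large `j`, then it vanishes for all `j > d`. -/
theorem subsingleton_ext_of_ringKrullDim_le {d : ℕ} (hd : ringKrullDim R ≤ d) (e : ℕ)
    (h : ∀ j, e < j → ∀ (N : Type u) [AddCommGroup N] [Module R N] [Module.Finite R N],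
      Subsingleton (Ext (ModuleCat.of R N) Y j)) :
    ∀ j, d < j → ∀ (N : Type u) [AddCommGroup N] [Module R N] [Module.Finite R N],
      Subsingleton (Ext (ModuleCat.of R N) Y j) := by
  induction e with
  | zero => exact fun j hj => h j (by omega)
  | succ e ih =>
    by_cases hde : e + 1 ≤ d
    · exact fun j hj => h j (by omega)
    refine ih fun j hj N _ _ _ => ?_
    obtain rfl | hj' : j = e + 1 ∨ e + 1 < j := by omega
    · by_cases hk : Subsingleton (Ext (ModuleCat.of R (R ⧸ maximalIdeal R)) Y (e + 1))
      · exact subsingleton_ext_of_subsingleton_ext_residueField Y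
          (fun N => h (e + 1 + 1) (by omega) N) hk N
      -- With `N = R`, which is projective, `s = 0` is allowed; the resulting `e + 1 ≤ d` is a
      -- contradiction.
      · have := le_add_of_supportDim_le Y (fun N => h (e + 1 + 1) (by omega) N) hk d 0 R
          (fun j hj => by
            obtain ⟨j, rfl⟩ : ∃ i, j = i + 1 := ⟨j - 1, by omega⟩
            exact subsingleton_ext_of_projective Y j)
          (by rwa [Module.supportDim_self_eq_ringKrullDim])
        omega
    · exact h j hj' N

theorem subsingleton_ext_of_isRegular {d : ℕ}
    (h : ∀ j, d < j → ∀ (N : Type u) [AddCommGroup N] [Module R N] [Module.Finite R N],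
      Subsingleton (Ext (ModuleCat.of R N) Y j)) (rs : List R) :
    ∀ (N : Type u) [AddCommGroup N] [Module R N] [Module.Finite R N],
      (∀ x ∈ rs, x ∈ maximalIdeal R) → RingTheory.Sequence.IsWeaklyRegular N rs →
      ∀ j, d < j + rs.length → Subsingleton (Ext (ModuleCat.of R N) Y j) := by
  induction rs with
  | nil => exact fun N _ _ _ _ _ j hj => h j hj N
  | cons x rs ih =>
    intro N _ _ _ hmem hreg j hj
    rw [RingTheory.Sequence.isWeaklyRegular_cons_iff] at hreg
    rw [List.length_cons] at hj
    exact subsingleton_ext_of_quotSMulTop Y (hmem x (by simp)) hreg.1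
      (ih _ (fun y hy => hmem y (by simp [hy])) hreg.2 (j + 1) (by omega))

end Bass

/-! ### Vanishing of higher `Ext` implies membership in `G(R)`. -/

section TotallyReflexive

open Abelian

variable {R : Type u} [CommRing R]

theorem exists_comp_eq_of_subsingleton_ext_one {N₁ N₂ N₃ Y : Type u} [AddCommGroup N₁]
    [Module R N₁] [AddCommGroup N₂] [Module R N₂] [AddCommGroup N₃] [Module R N₃]
    [AddCommGroup Y] [Module R Y]
    {f : N₁ →ₗ[R] N₂} {g : N₂ →ₗ[R] N₃} (hf : Function.Injective f)
    (hg : Function.Surjective g) (hfg : Function.Exact f g)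
    (h : Subsingleton (Ext (ModuleCat.of R N₃) (ModuleCat.of R Y) 1)) (φ : N₁ →ₗ[R] Y) :
    ∃ ψ : N₂ →ₗ[R] Y, ψ ∘ₗ f = φ := by
  obtain ⟨x, hx⟩ := Ext.contravariant_sequence_exact₁ (shortExact_of_exact hf hg hfg)
    (ModuleCat.of R Y) (Ext.mk₀ (ModuleCat.ofHom φ)) (Nat.add_comm 1 0) (h.elim _ _)
  obtain ⟨ψ, rfl⟩ := (Ext.mk₀_bijective _ _).2 x
  rw [Ext.mk₀_comp_mk₀] at hx
  refine ⟨ψ.hom, ?_⟩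
  have := (Ext.mk₀_bijective _ _).1 hx
  exact congrArg ModuleCat.Hom.hom this

theorem surjective_dualMap_of_subsingleton_ext_one {N₁ N₂ N₃ : Type u} [AddCommGroup N₁]
    [Module R N₁] [AddCommGroup N₂] [Module R N₂] [AddCommGroup N₃] [Module R N₃]
    {f : N₁ →ₗ[R] N₂} {g : N₂ →ₗ[R] N₃} (hf : Function.Injective f)
    (hg : Function.Surjective g) (hfg : Function.Exact f g)
    (h : Subsingleton (Ext (ModuleCat.of R N₃) (ModuleCat.of R R) 1)) :
    Function.Surjective f.dualMap :=
  exists_comp_eq_of_subsingleton_ext_one hf hg hfg h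

theorem exact_dualMap {N₁ N₂ N₃ : Type*} [AddCommGroup N₁]
    [Module R N₁] [AddCommGroup N₂] [Module R N₂] [AddCommGroup N₃] [Module R N₃]
    {f : N₁ →ₗ[R] N₂} {g : N₂ →ₗ[R] N₃}
    (hg : Function.Surjective g) (hfg : Function.Exact f g) :
    Function.Exact g.dualMap f.dualMap :=
  LinearMap.exact_lcomp_of_exact_of_surjective R hfg hg

variable [IsNoetherianRing R] {d : ℕ}
  (h : ∀ j, d < j → ∀ (N : Type u) [AddCommGroup N] [Module R N] [Module.Finite R N],
    Subsingleton (Ext (ModuleCat.of R N) (ModuleCat.of R R) j))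

omit [IsNoetherianRing R] in
/-- Vanishing of `Ext^i(-, R)` for `i > 0` passes to syzygies. -/
theorem subsingleton_ext_ker {K F : Type u} [AddCommGroup K] [Module R K]
    [AddCommGroup F] [Module R F] [Module.Free R F] {f : F →ₗ[R] K}
    (hf : Function.Surjective f) {n : ℕ}
    (hK : ∀ j, n + 1 < j → Subsingleton (Ext (ModuleCat.of R K) (ModuleCat.of R R) j)) (j : ℕ)
    (hj : n < j) : Subsingleton (Ext (ModuleCat.of R (LinearMap.ker f)) (ModuleCat.of R R) j) := by
  obtain ⟨j, rfl⟩ : ∃ i, j = i + 1 := ⟨j - 1, by omega⟩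
  exact subsingleton_ext_left (LinearMap.ker f).subtype_injective hf
    (LinearMap.exact_subtype_ker_map f) _ (subsingleton_ext_of_projective _ _)
    (hK _ (by omega))

-- Dualizing `0 → ker f → F → K → 0` stays exact, so `Ext^i(K*, R)` is controlled by `Ext^(i+1)((ker
-- f)*, R)`; after `m` syzygies the degree exceeds `d`.
include h in
theorem subsingleton_ext_dual (m : ℕ) :
    ∀ (K : Type u) [AddCommGroup K] [Module R K] [Module.Finite R K],
      (∀ j, 0 < j → Subsingleton (Ext (ModuleCat.of R K) (ModuleCat.of R R) j)) →
      ∀ i, 0 < i → d < i + m →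
        Subsingleton (Ext (ModuleCat.of R (Module.Dual R K)) (ModuleCat.of R R) i) := by
  induction m with
  | zero => exact fun K _ _ _ _ i _ hi => h i hi _
  | succ m ih =>
    intro K _ _ _ hK i hi him
    obtain ⟨F, _, _, _, _, f, hf⟩ := Module.exists_finite_presentation R K
    obtain ⟨i, rfl⟩ : ∃ j, i = j + 1 := ⟨i - 1, by omega⟩
    refine subsingleton_ext_left (LinearMap.dualMap_injective_of_surjective hf)
      (surjective_dualMap_of_subsingleton_ext_one (LinearMap.ker f).subtype_injective hf
        (LinearMap.exact_subtype_ker_map f) (hK 1 one_pos))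
      (exact_dualMap hf (LinearMap.exact_subtype_ker_map f)) _
      (subsingleton_ext_of_projective _ _)
      (ih _ (subsingleton_ext_ker hf fun j hj => hK j (by omega)) (i + 1 + 1) (by omega)
        (by omega))

include h in
theorem surjective_dual_eval (K : Type u) [AddCommGroup K] [Module R K] [Module.Finite R K]
    (hK : ∀ j, 0 < j → Subsingleton (Ext (ModuleCat.of R K) (ModuleCat.of R R) j)) :
    Function.Surjective (Module.Dual.eval R K) := by
  intro x
  obtain ⟨F, _, _, _, _, f, hf⟩ := Module.exists_finite_presentation R K
  -- The functional `x` on `K*` extends to `F*` because `Ext^1((ker f)*, R) = 0`, and `F` is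
  -- reflexive.
  obtain ⟨y, hy⟩ := exists_comp_eq_of_subsingleton_ext_one
    (LinearMap.dualMap_injective_of_surjective hf)
    (surjective_dualMap_of_subsingleton_ext_one (LinearMap.ker f).subtype_injective hf
      (LinearMap.exact_subtype_ker_map f) (hK 1 one_pos))
    (exact_dualMap hf (LinearMap.exact_subtype_ker_map f))
    (subsingleton_ext_dual h d _ (subsingleton_ext_ker hf fun j hj => hK j (by omega)) 1
      one_pos (by omega)) x
  obtain ⟨z, rfl⟩ := (Module.bijective_dual_eval R F).2 y
  refine ⟨f z, ?_⟩
  rw [← hy]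
  rfl

include h in
theorem injective_dual_eval (K : Type u) [AddCommGroup K] [Module R K] [Module.Finite R K]
    (hK : ∀ j, 0 < j → Subsingleton (Ext (ModuleCat.of R K) (ModuleCat.of R R) j)) :
    Function.Injective (Module.Dual.eval R K) := by
  rw [injective_iff_map_eq_zero]
  intro k hk
  obtain ⟨F, _, _, _, _, f, hf⟩ := Module.exists_finite_presentation R K
  obtain ⟨y, rfl⟩ := hf k
  have hsurj : Function.Surjective (LinearMap.ker f).subtype.dualMap :=
    surjective_dualMap_of_subsingleton_ext_one (LinearMap.ker f).subtype_injective hf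
      (LinearMap.exact_subtype_ker_map f) (hK 1 one_pos)
  have hexact := exact_dualMap hf (LinearMap.exact_subtype_ker_map f)
  have hexact' := exact_dualMap hsurj hexact
  -- The image of `y` in `F**` comes from `(ker f)**`, hence from `ker f` by surjectivity of
  -- biduality there.
  obtain ⟨z, hz⟩ := (hexact' (Module.Dual.eval R F y)).1 (by
    ext φ
    exact LinearMap.congr_fun hk φ)
  obtain ⟨w, rfl⟩ := surjective_dual_eval h _
    (subsingleton_ext_ker hf fun j hj => hK j (by omega)) z
  have hw : (w : F) = y := (Module.bijective_dual_eval R F).1 hz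
  rw [← hw]
  exact w.2

include h in
theorem isGClass_of_subsingleton_ext (K : Type u) [AddCommGroup K] [Module R K]
    [Module.Finite R K]
    (hK : ∀ j, 0 < j → Subsingleton (Ext (ModuleCat.of R K) (ModuleCat.of R R) j)) :
    IsGClass R K where
  finite := inferInstance
  ext_self := hK
  ext_dual i hi := subsingleton_ext_dual h d K hK i hi (by omega)
  bijective_biduality := ⟨injective_dual_eval h K hK, surjective_dual_eval h K hK⟩

end TotallyReflexive

/-! ### Building `G`-resolutions from syzygies. -/

section Resolution

open Abelian

variable {R : Type u} [CommRing R]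

theorem HasGResolutionLE.of_equiv {M : Type v} {N : Type*} [AddCommGroup M] [Module R M]
    [AddCommGroup N] [Module R N] {n : ℕ} (hM : HasGResolutionLE R M n) (e : M ≃ₗ[R] N) :
    HasGResolutionLE R N n := by
  obtain ⟨G, d, ε, hG, hε, hdε, hd, hn⟩ := hM
  refine ⟨G, d, e.toLinearMap ∘ₗ ε, hG, e.surjective.comp hε, fun x => ?_, hd, hn⟩
  rw [← hdε x]
  simp

theorem HasGResolutionLE.of_exact {K F : Type u} {M : Type v} [AddCommGroup K] [Module R K]
    [AddCommGroup F] [Module R F] [AddCommGroup M] [Module R M] {f : K →ₗ[R] F} {g : F →ₗ[R] M}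
    (hf : Function.Injective f) (hg : Function.Surjective g) (hfg : Function.Exact f g)
    (hF : IsGClass R F) {n : ℕ} (hK : HasGResolutionLE R K n) : HasGResolutionLE R M (n + 1) := by
  obtain ⟨G, d, ε, hG, hε, hdε, hd, hn⟩ := hK
  refine ⟨fun l => match l with | 0 => ModuleCat.of R F | l + 1 => G l,
    fun l => match l with | 0 => f ∘ₗ ε | l + 1 => d l, g, ?_, hg, ?_, ?_, ?_⟩
  · rintro (_ | l)
    exacts [hF, hG l]
  · intro x
    rw [hfg x]
    change x ∈ Set.range f ↔ x ∈ Set.range (f ∘ ε)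
    rw [hε.range_comp]
  · rintro (_ | l)
    · intro x
      rw [← hdε x]
      exact map_eq_zero_iff f hf
    · exact hd l
  · rintro (_ | l) hl
    · omega
    · exact hn l (by omega)

/-- `h0` is needed because resolutions are indexed by all of `ℕ`, so the zero padding must lie in
`G(R)` too. -/
theorem IsGClass.hasGResolutionLE_zero {K : Type u} [AddCommGroup K] [Module R K]
    (hK : IsGClass R K) (h0 : IsGClass R PUnit.{u + 1}) : HasGResolutionLE R K 0 := by
  refine ⟨fun l => match l with | 0 => ModuleCat.of R K | _ + 1 => ModuleCat.of R PUnit.{u + 1},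
    fun _ => 0, LinearMap.id, ?_, Function.surjective_id, ?_, ?_, ?_⟩
  · rintro (_ | l)
    exacts [hK, h0]
  · intro x; simp [eq_comm]
  · intro l x
    have : x = 0 := Subsingleton.elim (α := PUnit) _ _
    simp [this]
  · rintro (_ | l) hl
    · omega
    · exact inferInstanceAs (Subsingleton PUnit)

theorem hasGResolutionLE_of_subsingleton_ext [IsNoetherianRing R] {d : ℕ}
    (h : ∀ j, d < j → ∀ (N : Type u) [AddCommGroup N] [Module R N] [Module.Finite R N],
      Subsingleton (Ext (ModuleCat.of R N) (ModuleCat.of R R) j)) (n : ℕ) :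
    ∀ (N : Type u) [AddCommGroup N] [Module R N] [Module.Finite R N],
      (∀ j, n < j → Subsingleton (Ext (ModuleCat.of R N) (ModuleCat.of R R) j)) →
      HasGResolutionLE R N n := by
  induction n with
  | zero =>
    exact fun N _ _ _ hN => (isGClass_of_subsingleton_ext h N hN).hasGResolutionLE_zero
      (isGClass_of_subsingleton_ext h _ fun j _ => subsingleton_ext_of_subsingleton _ j)
  | succ n ih =>
    intro N _ _ _ hN
    obtain ⟨F, _, _, _, _, f, hf⟩ := Module.exists_finite_presentation R N
    refine .of_exact (LinearMap.ker f).subtype_injective hf (LinearMap.exact_subtype_ker_map f)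
      (isGClass_of_subsingleton_ext h F fun j hj => ?_) (ih _ (subsingleton_ext_ker hf hN))
    obtain ⟨j, rfl⟩ : ∃ i, j = i + 1 := ⟨j - 1, by omega⟩
    exact subsingleton_ext_of_projective _ _

end Resolution

/-! ### The Auslander–Bridger bound and localization. -/

section Gorenstein

open Abelian IsLocalRing

/-- Over a Noetherian local ring `R` of dimension `d` with finite injective dimension over itself,
a nonzero finite module `M` has finite depth and a `G`-resolution of length
`d - depth M`. -/
theorem exists_depth_eq_and_hasGResolutionLE {R : Type u} [CommRing R] [IsNoetherianRing R]
    [IsLocalRing R] {e d : ℕ} (hR : HasInjectiveDimensionLE (ModuleCat.of R R) e)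
    (hd : ringKrullDim R ≤ d) (M : Type v) [AddCommGroup M] [Module R M] [Module.Finite R M]
    [Nontrivial M] :
    ∃ s n : ℕ, depth R M = s ∧ s + n = d ∧ HasGResolutionLE R M n := by
  have h : ∀ j, d < j → ∀ (N : Type u) [AddCommGroup N] [Module R N] [Module.Finite R N],
      Subsingleton (Ext (ModuleCat.of R N) (ModuleCat.of R R) j) :=
    subsingleton_ext_of_ringKrullDim_le (ModuleCat.of R R) hd e fun j hj N _ _ _ =>
      HasInjectiveDimensionLT.subsingleton _ (e + 1) j hj _
  -- `M` lives in another universe, so `Ext` is computed on an isomorphic quotient of `R^k`.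
  obtain ⟨k, f, hf⟩ := Module.Finite.exists_fin' R M
  let ε := f.quotKerEquivOfSurjective hf
  have hext (rs : List R) (hrs : ∀ r ∈ rs, r ∈ maximalIdeal R)
      (hreg : RingTheory.Sequence.IsRegular M rs) :=
    subsingleton_ext_of_isRegular (ModuleCat.of R R) h rs ((Fin k → R) ⧸ LinearMap.ker f) hrs
      ((ε.isRegular_congr rs).2 hreg).1
  have hle (rs : List R) (hrs : ∀ r ∈ rs, r ∈ maximalIdeal R)
      (hreg : RingTheory.Sequence.IsRegular M rs) : rs.length ≤ d := by
    by_contra! hlt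
    have hG := isGClass_of_subsingleton_ext h ((Fin k → R) ⧸ LinearMap.ker f)
      fun j _ => hext rs hrs hreg j (by omega)
    -- A sequence longer than `d` kills `Ext^0` as well: the dual is zero, yet the module is
    -- reflexive.
    have : Subsingleton (Module.Dual R ((Fin k → R) ⧸ LinearMap.ker f)) :=
      (subsingleton_ext_zero_iff _).1 (hext rs hrs hreg 0 (by omega))
    have := (hG.bijective_biduality.1.comp ε.symm.injective).subsingleton
    exact not_subsingleton M this
  let S : Set ℕ := {m | ∃ rs : List R, (∀ r ∈ rs, r ∈ maximalIdeal R) ∧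
    RingTheory.Sequence.IsRegular M rs ∧ rs.length = m}
  have hS : S.Nonempty := ⟨0, [], by simp, .nil R M, rfl⟩
  have hb : BddAbove S := ⟨d, by rintro _ ⟨rs, h₁, h₂, rfl⟩; exact hle rs h₁ h₂⟩
  obtain ⟨rs, h₁, h₂, h₃⟩ := Nat.sSup_mem hS hb
  have hdepth : depth R M = (sSup S : ℕ) := by
    rw [depth, if_neg (not_subsingleton M)]
    refine le_antisymm (iSup_le fun rs => iSup_le fun h₁ => iSup_le fun h₂ => ?_) ?_
    · exact_mod_cast le_csSup hb ⟨rs, h₁, h₂, rfl⟩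
    · rw [← h₃]
      exact le_iSup_of_le rs (le_iSup_of_le h₁ (le_iSup_of_le h₂ le_rfl))
  have hsd : sSup S ≤ d := h₃ ▸ hle rs h₁ h₂
  refine ⟨sSup S, d - sSup S, hdepth, by omega,
    (hasGResolutionLE_of_subsingleton_ext h _ _ fun j hj => hext rs h₁ h₂ j ?_).of_equiv ε⟩
  omega

attribute [local instance] RingHomInvPair.of_ringEquiv in
theorem hasInjectiveDimensionLE_self_of_ringEquiv {R S : Type u} [CommRing R] [CommRing S]
    (e : R ≃+* S) {n : ℕ} (h : HasInjectiveDimensionLE (ModuleCat.of R R) n) :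
    HasInjectiveDimensionLE (ModuleCat.of S S) n := by
  let e' : ModuleCat.of R R ≃ₛₗ[RingHomClass.toRingHom e] ModuleCat.of S S :=
    { e.toAddEquiv with map_smul' := fun r x => map_mul e r x }
  exact (ModuleCat.hasInjectiveDimensionLE_iff_of_semiLinearEquiv e e' n).1 h

theorem exists_hasInjectiveDimensionLE_localization_localization {R : Type u} [CommRing R]
    [IsGorensteinRing R] (q : Ideal R) [q.IsPrime] (P : Ideal (Localization.AtPrime q))
    [P.IsPrime] :
    ∃ n : ℕ, HasInjectiveDimensionLE
      (ModuleCat.of (Localization.AtPrime P) (Localization.AtPrime P)) n := by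
  obtain ⟨n, hn⟩ := IsGorensteinRing.finite_injectiveDimension
    (P.comap (algebraMap R (Localization.AtPrime q)))
  exact ⟨n, hasInjectiveDimensionLE_self_of_ringEquiv
    (IsLocalization.localizationLocalizationAtPrimeIsoLocalization q.primeCompl P).toRingEquiv hn⟩

end Gorenstein

/-! ### Heights in a quotient by a prime. -/

section Height

theorem height_add_ringKrullDim_quotient_le {R : Type*} [CommRing R] (P : Ideal R)
    [hP : P.IsPrime] :
    (P.height : WithBot ℕ∞) + ringKrullDim (R ⧸ P) ≤ ringKrullDim R := by
  have h : ringKrullDim (R ⧸ P) = Order.coheight (⟨P, hP⟩ : PrimeSpectrum R) := by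
    rw [ringKrullDim_quotient, Order.coheight_eq_krullDim_Ici]
    rfl
  have : Nonempty (PrimeSpectrum R) := ⟨⟨P, hP⟩⟩
  rw [h, show P.height = _ from PrimeSpectrum.height_eq_orderHeight ⟨P, hP⟩, ringKrullDim,
    Order.krullDim_eq_iSup_height_add_coheight_of_nonempty]
  exact_mod_cast le_iSup (fun a : PrimeSpectrum R => Order.height a + Order.coheight a) ⟨P, hP⟩

/-- The height of a proper ideal of `R/P` is at most `dim R - ht P`. -/
theorem height_add_height_map_le {R : Type*} [CommRing R] [IsLocalRing R] {a : Ideal R}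
    (ha : a ≤ IsLocalRing.maximalIdeal R) (P : Ideal R) [hP : P.IsPrime] :
    ((P.height + ((a ⊔ P).map (Ideal.Quotient.mk P)).height : ℕ∞) : WithBot ℕ∞) ≤
      ringKrullDim R := by
  -- Properness is essential, as the unit ideal has height `∞`.
  have hne : (a ⊔ P).map (Ideal.Quotient.mk P) ≠ ⊤ := by
    intro h
    rw [Ideal.map_eq_top_iff_of_ker_le _
      (by rw [Ideal.mk_ker]; exact le_sup_right)
      (RingHom.isIntegral_of_surjective _ Ideal.Quotient.mk_surjective)] at h
    exact (IsLocalRing.maximalIdeal.isMaximal R).ne_top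
      (top_le_iff.1 (h ▸ sup_le ha (IsLocalRing.le_maximalIdeal hP.ne_top)))
  push_cast
  exact (add_le_add_right (Ideal.height_le_ringKrullDim_of_ne_top hne) _).trans
    (height_add_ringKrullDim_quotient_le P)

end Height

theorem toEReal_natCast (n : ℕ) : toEReal n = n := by
  simp only [toEReal, ENat.toENNReal_coe]
  rfl

end GDim

theorem proposition2p8 {R : Type u} [CommRing R] [GDim.IsGorensteinRing R]
    {M : Type v} [AddCommGroup M] [Module R M] [Module.Finite R M]
    (a b : Ideal R) (hab : b ≤ a) (n : ℕ)
    (q : Ideal R) [q.IsPrime] (haq : a ≤ q)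
    (hq : (n : WithBot ℕ∞) ≤ ringKrullDim (R ⧸ q)) :
    b.map (algebraMap R (Localization.AtPrime q)) ≤
      GDim.gdimIdeal (Localization.AtPrime q) (LocalizedModule q.primeCompl M)
        (GDim.toEReal q.height - GDim.toEReal (GDim.adjustedDepthAt a b M n)) := by
  refine le_iInf₂ fun P hP => ?_
  by_contra hbP
  refine not_le_of_gt (α := EReal) hP ?_
  rw [GDim.gdim]
  split_ifs with hM
  · exact bot_le
  rw [not_subsingleton_iff_nontrivial] at hM
  have := IsLocalization.isNoetherianRing q.primeCompl (Localization.AtPrime q) inferInstance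
  have := IsLocalization.isNoetherianRing P.asIdeal.primeCompl
    (Localization.AtPrime P.asIdeal) inferInstance
  have ha : a.map (algebraMap R (Localization.AtPrime q)) ≤
      IsLocalRing.maximalIdeal (Localization.AtPrime q) := by
    rw [← Localization.AtPrime.map_eq_maximalIdeal]
    exact Ideal.map_mono haq
  have hht := GDim.height_add_height_map_le ha P.asIdeal
  rw [IsLocalization.AtPrime.ringKrullDim_eq_height q, WithBot.coe_le_coe] at hht
  obtain ⟨e, he⟩ := GDim.exists_hasInjectiveDimensionLE_localization_localization q P.asIdeal
  obtain ⟨d, hd⟩ := ENat.ne_top_iff_exists.1 (P.asIdeal.height_ne_top P.2.ne_top)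
  obtain ⟨c, hc⟩ := ENat.ne_top_iff_exists.1 (q.height_ne_top Ideal.IsPrime.ne_top')
  obtain ⟨s, l, hs, hsl, hres⟩ := GDim.exists_depth_eq_and_hasGResolutionLE he
    (d := d) (by rw [IsLocalization.AtPrime.ringKrullDim_eq_height P.asIdeal, ← hd]; rfl)
    (LocalizedModule P.asIdeal.primeCompl (LocalizedModule q.primeCompl M))
  -- Here `s + l = ht P`, with `s` the depth of `(M_q)_P`.
  have hlam : GDim.adjustedDepthAt a b M n + l ≤ q.height := by
    refine le_trans ?_ hht
    refine (add_le_add_left ((iInf₂_le (⟨q, inferInstance⟩ : PrimeSpectrum R) hq).trans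
      (iInf₂_le P hbP)) _).trans ?_
    rw [hs, ← hd, ← hsl, Nat.cast_add]
    exact le_of_eq (by ring)
  -- Since `ht q` is finite, so is `λ`; the final comparison takes place in `ℝ`.
  obtain ⟨t, ht⟩ := ENat.ne_top_iff_exists.1
    (fun h => by simp [h, ← hc] at hlam : GDim.adjustedDepthAt a b M n ≠ ⊤)
  rw [← hc, ← ht] at hlam ⊢
  refine (iInf₂_le l hres).trans ?_
  rw [GDim.toEReal_natCast, GDim.toEReal_natCast]
  have hlt : (l : ℝ) ≤ c - t := by
    have : t + l ≤ c := by exact_mod_cast hlam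
    have : (t : ℝ) + l ≤ c := by exact_mod_cast this
    linarith
  rw [← EReal.coe_coe_eq_natCast, ← EReal.coe_coe_eq_natCast, ← EReal.coe_coe_eq_natCast,
    ← EReal.coe_sub]
  exact EReal.coe_le_coe_iff.2 hlt
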